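/- Fix path-loss exponents $\alpha>2$ (data links) and $\beta>2$ (power links), a constant $\nu>1$, a duty cycle $\omega\in(0,1]$, a target SINR $\theta>0$, $K\in\mathbb N$ and $\epsilon\in(0,1)$. Cellular network. The typical base station $Y_0$ lies at the origin of $\mathbb R^2$; the other base stations form a homogeneous Poisson process of density $\lambda_b$. Given the base stations, each base station $Y$ serves one active mobile $U_Y$, uniformly distributed in the Voronoi cell of $Y$, independently over $Y$; write $U_0=U_{Y_0}$. All active mobiles transmit with power $p$. Let $\mathcal C$ be the set of the base stations serving the $K$ interfering mobiles nearest to the origin, let $\sigma^2>0$ be the noise variance and let $$P_{\mathsf{out}}(\lambda_b,p)=\Pr\left(\frac{p|U_0|^{-\alpha}}{I+\sigma^2}<\theta\right),\qquad I=\sum_{Y\notin\{Y_0\}\cup\mathcal C}p|U_Y|^{-\alpha}.$$ Let $\mu>0$ be a constant such that, in the network with $\lambda_b=1$, $\Pr\left(\sum_{Y\notin\{Y_0\}\cup\mathcal C}|U_Y|^{-\alpha}-\theta^{-1}|U_0|^{-\alpha}+\mu>0\right)=\epsilon$. Directed power transfer with infinite storage. Time is slotted. In every slot the power beacons form an independent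 homogeneous Poisson process $\Psi$ of density $\lambda_p$, independent of the positions of the mobiles, and a mobile at $x$ harvests the raw power $$P=z_mq\max(|x-T_0|,\nu)^{-\beta}+z_sq\sum_{T\in\Psi\setminus\{T_0\}}\max(|x-T|,\nu)^{-\beta},$$ where $T_0$ is the beacon nearest to $x$, $q$ is the beacon power and $z_m,z_s>0$ are the main-lobe and side-lobe responses. In each slot the mobile has a packet with probability $\omega$, independently, and transmits it with power $p$ if enough energy is stored; the storage capacity is infinite. The feasibility region $\mathcal F_h$ is the set of all $(q,\lambda_b,\lambda_p)$ with $q,\lambda_p\ge 0$ and $\lambda_b>0$ for which there is a $p>0$ such that the probability that a mobile has enough stored energy to transmit with power $p$ tends to $1$ as time grows, and $P_{\mathsf{out}}(\lambda_b,p)\le\epsilon$. Put $\kappa=\omega\sigma^2\nu^\beta/\mu$. Then for every $\lambda_0>0$ there are a function $e:\mathbb R\to\mathbb R$ with $e(r)\to0$ as $r\to\infty$ and a number $R$ such that, for all $z_m,z_s,\sigma^2>0$, every $(q,\lambda_b,\lambda_p)\in\mathbb R_+^3$ with $\lambda_b\ge\lambda_0$ and $z_mq/\sigma^2\ge R$ that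 satisfies $$z_mq\,\lambda_p\lambda_b^{\alpha/2}\ \ge\ \frac{\kappa}{\pi\nu^2}+e\!\left(\frac{z_mq}{\sigma^2}\right)\qquad\text{and}\qquad (z_mq)^{2/\alpha}\lambda_b\ \ge\ \kappa^{2/\alpha}$$ belongs to $\mathcal F_h$. -/

import Mathlib

open MeasureTheory ProbabilityTheory Filter Topology Set
open scoped ENNReal NNReal

/-- The Euclidean plane. -/
abbrev Plane : Type := EuclideanSpace ℝ (Fin 2)

section PointProcesses

variable {Ω : Type} [MeasurableSpace Ω]

/-- The number of points of the random point set `Ψ` that lie in `B`. -/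
noncomputable def pointCount (Ψ : Ω → Set Plane) (B : Set Plane) (ω : Ω) : ℕ∞ :=
  (Ψ ω ∩ B).encard

/-- The σ-algebra generated by a random point set, that is, by its counts in Borel sets. -/
noncomputable abbrev pointSigma (Ψ : Ω → Set Plane) : MeasurableSpace Ω :=
  ⨆ B : {B : Set Plane // MeasurableSet B},
    MeasurableSpace.comap (pointCount Ψ B.1) inferInstance

/-- `Ψ` is a homogeneous Poisson point process of density `lam` on the plane: counts are random
variables, the count in a Borel set of finite area is Poisson distributed with mean `lam` times the
area, and counts in pairwise disjoint sets are independent. -/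
structure IsPoissonProcess (P : Measure Ω) (lam : ℝ≥0) (Ψ : Ω → Set Plane) : Prop where
  measurable_count : ∀ B : Set Plane, MeasurableSet B → Measurable (pointCount Ψ B)
  law_count : ∀ B : Set Plane, MeasurableSet B → volume B ≠ ∞ →
    P.map (pointCount Ψ B) =
      (poissonMeasure (lam * (volume B).toNNReal)).map (Nat.cast : ℕ → ℕ∞)
  indep_count : ∀ B : ℕ → Set Plane, (∀ i, MeasurableSet (B i)) → (∀ i, volume (B i) ≠ ∞) →
    Pairwise (fun i j => Disjoint (B i) (B j)) → iIndepFun (fun i => pointCount Ψ (B i)) P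

end PointProcesses

section CellularNetwork

/-- The Voronoi cell of the point `y n` with respect to all the points `y m`. -/
def voronoiCell (y : ℕ → Plane) (n : ℕ) : Set Plane :=
  {x | ∀ m, dist x (y n) ≤ dist x (y m)}

/-- The uplink network seen from the typical base station. `Y n`, `n = 0, 1, …`, are the base
stations and `U n` is the active mobile served by `Y n`. The typical base station `Y 0` is at the
origin, the other base stations form a Poisson process of density `lam` (Palm version of the
process), and, given all base stations, the active mobiles are independent with `U n` uniformly
distributed in the Voronoi cell of `Y n`. -/
structure IsCellularNetwork {Ω : Type} [MeasurableSpace Ω] (P : Measure Ω) (lam : ℝ≥0)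
    (Y U : ℕ → Ω → Plane) : Prop where
  prob : IsProbabilityMeasure P
  measurable_station : ∀ n, Measurable (Y n)
  measurable_mobile : ∀ n, Measurable (U n)
  origin : ∀ w, Y 0 w = 0
  injective : ∀ᵐ w ∂P, Function.Injective (fun n => Y n w)
  poisson : IsPoissonProcess P lam (fun w => range (fun n => Y (n + 1) w))
  uniform : ∀ (s : Finset ℕ) (B : ℕ → Set Plane) (A : Set (ℕ → Plane)),
    (∀ n, MeasurableSet (B n)) → MeasurableSet A →
    P ({w | (fun n => Y n w) ∈ A} ∩ ⋂ n ∈ s, {w | U n w ∈ B n}) =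
      ∫⁻ w in {w | (fun n => Y n w) ∈ A},
        ∏ n ∈ s, (ProbabilityTheory.cond volume (voronoiCell (fun m => Y m w) n)) (B n) ∂P

/-- Path gain `‖x‖ ^ (-α)` of a data link from a mobile at `x` to the origin. -/
noncomputable def pathGain (α : ℝ) (x : Plane) : ℝ≥0∞ := ‖x‖ₑ ^ (-α)

/-- Indices of the mobiles whose interference to the typical base station is not cancelled: mobiles
`n ≠ 0` for which at least `K` interfering mobiles are strictly closer to the origin, so that `n` is
not among the `K` nearest interferers. -/
def uncancelled (K : ℕ) (u : ℕ → Plane) : Set ℕ :=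
  {n | n ≠ 0 ∧ (K : ℕ∞) ≤ {m | m ≠ 0 ∧ ‖u m‖ < ‖u n‖}.encard}

/-- Interference power at the typical base station when all active mobiles use power `p`. -/
noncomputable def interference (α : ℝ) (K : ℕ) (p : ℝ) (u : ℕ → Plane) : ℝ≥0∞ :=
  ∑' n : uncancelled K u, ENNReal.ofReal p * pathGain α (u n)

/-- The received signal-to-interference-and-noise ratio, with noise variance `σ ^ 2`. -/
noncomputable def sinr (α : ℝ) (K : ℕ) (σ p : ℝ) (u : ℕ → Plane) : ℝ≥0∞ :=
  ENNReal.ofReal p * pathGain α (u 0) / (interference α K p u + ENNReal.ofReal (σ ^ 2))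

/-- The outage constraint `P_out ≤ ε` for the cellular network with base-station density `lamb` and
mobile transmission power `p`. -/
def OutageConstraint (α θ : ℝ) (K : ℕ) (ε σ lamb p : ℝ) : Prop :=
  ∀ (Ω : Type) [MeasurableSpace Ω] (P : Measure Ω) (Y U : ℕ → Ω → Plane),
    IsCellularNetwork P lamb.toNNReal Y U →
      P {w | sinr α K σ p (fun n => U n w) < ENNReal.ofReal θ} ≤ ENNReal.ofReal ε

/-- The defining equation of the constant `μ`: in the network with base-station density `1`,
`∑ ‖U_Y‖ ^ (-α) - θ⁻¹ ‖U_0‖ ^ (-α) + μ > 0` holds with probability exactly `ε`, where the sum is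
over the uncancelled interferers. -/
def IsNoiseThreshold (α θ : ℝ) (K : ℕ) (ε μ : ℝ) : Prop :=
  ∀ (Ω : Type) [MeasurableSpace Ω] (P : Measure Ω) (Y U : ℕ → Ω → Plane),
    IsCellularNetwork P 1 Y U →
      P {w | ENNReal.ofReal θ⁻¹ * pathGain α (U 0 w) <
        (∑' n : uncancelled K (fun n => U n w), pathGain α (U n w)) + ENNReal.ofReal μ} =
        ENNReal.ofReal ε

end CellularNetwork

section PowerTransfer

open scoped Classical in
/-- Raw power received under directed power transfer by a mobile at `x` from the power beacons
`T ∈ Ψ`, each transmitting with power `q`: the beacon nearest to `x` contributes with the main-lobe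
response `zm`, every other beacon with the side-lobe response `zs`. -/
noncomputable def directedPower (β ν zm zs q : ℝ) (Ψ : Set Plane) (x : Plane) : ℝ≥0∞ :=
  ∑' T : Ψ, ENNReal.ofReal
    ((if ∀ T' ∈ Ψ, dist x T ≤ dist x T' then zm else zs) * q * (max (dist x T) ν) ^ (-β))

/-- The slotted environment of a mobile. In slot `t` the power beacons are at `Ψ t`, a Poisson process
of density `lam`, the mobile is at `X t`, and the mobile has a packet to transmit on the event
`A t`, of probability `dc` (the duty cycle). The beacon processes of different slots, the packet
events of different slots, and the trajectory of the mobile are independent. -/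
structure IsChargingModel {Ω : Type} [MeasurableSpace Ω] (P : Measure Ω) (lam : ℝ≥0) (dc : ℝ)
    (Ψ : ℕ → Ω → Set Plane) (X : ℕ → Ω → Plane) (A : ℕ → Set Ω) : Prop where
  prob : IsProbabilityMeasure P
  poisson : ∀ t, IsPoissonProcess P lam (Ψ t)
  measurable_position : ∀ t, Measurable (X t)
  measurable_active : ∀ t, MeasurableSet (A t)
  prob_active : ∀ t, P (A t) = ENNReal.ofReal dc
  indep : iIndep
    (Sum.elim (fun t => pointSigma (Ψ t))
      (Sum.elim (fun t => MeasurableSpace.generateFrom {A t})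
        (fun _ : Unit => ⨆ t, MeasurableSpace.comap (X t) inferInstance))) P

open scoped Classical in
/-- Energy stored at the beginning of slot `t` in a storage unit of infinite capacity, initially
empty, for slots of unit length. In each slot the mobile harvests the energy `H t`; it transmits
with power `p`, spending the energy `p`, if it has a packet and at least the energy `p` is stored. -/
noncomputable def storedEnergy {Ω : Type} (p : ℝ) (A : ℕ → Set Ω) (H : ℕ → Ω → ℝ≥0∞) :
    ℕ → Ω → ℝ≥0∞
  | 0, _ => 0
  | t + 1, w =>
    storedEnergy p A H t w -
      (if w ∈ A t ∧ ENNReal.ofReal p ≤ storedEnergy p A H t w then ENNReal.ofReal p else 0) +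
      H t w

/-- Mobiles with infinite storage powered by directed power transfer can transmit with power `p`
with (steady-state) probability one. -/
def DirectedSustainable (β ν dc zm zs q lamp p : ℝ) : Prop :=
  ∀ (Ω : Type) [MeasurableSpace Ω] (P : Measure Ω) (Ψ : ℕ → Ω → Set Plane) (X : ℕ → Ω → Plane)
    (A : ℕ → Set Ω), IsChargingModel P lamp.toNNReal dc Ψ X A →
      Tendsto (fun t => P {w | ENNReal.ofReal p ≤
        storedEnergy p A (fun t w => directedPower β ν zm zs q (Ψ t w) (X t w)) t w}) atTop (𝓝 1)

/-- The feasibility region `F_h` of the hybrid network with directed power transfer and infinite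
storage: all triples `(q, lamb, lamp)` (beacon power, base-station density, beacon density) such
that the beacons can sustain some mobile transmission power `p` that satisfies the outage
constraint. A network of base stations has positive density. -/
def directedFeasibilityRegion (α β ν dc θ : ℝ) (K : ℕ) (ε zm zs σ : ℝ) : Set (ℝ × ℝ × ℝ) :=
  {x | 0 ≤ x.1 ∧ 0 < x.2.1 ∧ 0 ≤ x.2.2 ∧
    ∃ p : ℝ, 0 < p ∧ DirectedSustainable β ν dc zm zs x.1 x.2.2 p ∧
      OutageConstraint α θ K ε σ x.2.1 p}

end PowerTransfer

/-! ### Scale invariance of the cellular network -/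

section Scaling

/-! Dilating the plane by `√lamb` turns the network of density `lamb` into the one of density `1`
that defines `μ`. Path gains pick up the factor `lamb ^ (-α/2)`, so the outage constraint holds as
soon as `σ² / (p * lamb ^ (α/2)) ≤ μ` (`outageConstraint_of_le`). The proof takes the smallest such
power, `p = σ² / (μ * lamb ^ (α/2))`.

It remains to sustain this `p`. With infinite storage it suffices that the long-run harvest exceeds
the long-run demand `p * dc`, by the strong law of large numbers (`tendsto_measure_storedEnergy`).
With `b = 2 ^ (-β)`, a beacon within `ν` yields at least `G = zm * q * ν ^ (-β)`, and one within
`2ν` at least `b * G`. Writing `a = πν² * lamp`, the mean harvest is therefore at least about `G *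
(1 - (1-b) * exp(-a) - b * exp(-4a))`, whose slope at `a = 0` is `G * (1 + 3b)`. The demand is `p *
dc = G * x` with `x = κ / (zm * q * lamb ^ (α/2))`, and the first inequality of the theorem with `e
= 0` says `x ≤ a`. Large `zm * q / σ²` makes `x` small, where the slope above `1` beats the
concavity of the exponentials. The ring between `ν` and `2ν` thus pays for the linearisation, and
the error function can be taken to be zero.

The mobile may move arbitrarily, so the harvests of different slots share a random trajectory. The
events `nearBeacon` remove this dependence: the beacons are independent of the trajectory and
stationary, so conditioning on the position does not change the probability of a nearby beacon. -/

theorem Plane.volume_preimage_smul {c : ℝ} (hc : 0 < c) (B : Set Plane) :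
    volume ((fun x : Plane => c • x) ⁻¹' B) = ENNReal.ofReal (c ^ 2)⁻¹ * volume B := by
  rw [Measure.addHaar_preimage_smul volume hc.ne' B, finrank_euclideanSpace_fin,
    abs_of_pos (by positivity)]

theorem pointCount_range_smul {Ω : Type} {c : ℝ} (hc : c ≠ 0) (Z : ℕ → Ω → Plane) (B : Set Plane) :
    pointCount (fun w => range (fun n => c • Z n w)) B =
      pointCount (fun w => range (fun n => Z n w)) ((fun x : Plane => c • x) ⁻¹' B) := by
  funext w
  unfold pointCount
  have : range (fun n => c • Z n w) ∩ B =
      (fun x : Plane => c • x) '' (range (fun n => Z n w) ∩ (fun x : Plane => c • x) ⁻¹' B) := by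
    rw [image_inter_preimage, ← range_comp]
    rfl
  rw [this, (smul_right_injective Plane hc).encard_image]

theorem IsPoissonProcess.smul {Ω : Type} [MeasurableSpace Ω] {P : Measure Ω} {lam : ℝ≥0}
    {Z : ℕ → Ω → Plane} (h : IsPoissonProcess P lam (fun w => range (fun n => Z n w)))
    {c : ℝ} (hc : 0 < c) :
    IsPoissonProcess P (lam * (c ^ 2)⁻¹.toNNReal) (fun w => range (fun n => c • Z n w)) := by
  have hm : Measurable (fun x : Plane => c • x) := measurable_const_smul c
  have hfin : ∀ B : Set Plane, volume B ≠ ∞ → volume ((fun x : Plane => c • x) ⁻¹' B) ≠ ∞ := by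
    intro B hB
    rw [Plane.volume_preimage_smul hc]
    exact ENNReal.mul_ne_top ENNReal.ofReal_ne_top hB
  refine ⟨fun B hB => ?_, fun B hB hv => ?_, fun B hB hv hd => ?_⟩
  · rw [pointCount_range_smul hc.ne']
    exact h.measurable_count _ (hm hB)
  · rw [pointCount_range_smul hc.ne', h.law_count _ (hm hB) (hfin B hv),
      Plane.volume_preimage_smul hc, ENNReal.toNNReal_mul, mul_assoc]
    rfl
  · simp_rw [pointCount_range_smul hc.ne']
    exact h.indep_count _ (fun i => hm (hB i)) (fun i => hfin _ (hv i))
      fun i j hij => (hd hij).preimage _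

theorem isClosed_voronoiCell (y : ℕ → Plane) (n : ℕ) : IsClosed (voronoiCell y n) := by
  simp only [voronoiCell, ofPred_forall]
  exact isClosed_iInter fun m => isClosed_le (by fun_prop) (by fun_prop)

theorem voronoiCell_smul_preimage {c : ℝ} (hc : 0 < c) (y : ℕ → Plane) (n : ℕ) :
    (fun x : Plane => c • x) ⁻¹' voronoiCell (fun m => c • y m) n = voronoiCell y n := by
  ext x
  simp only [voronoiCell, mem_preimage, mem_ofPred_eq, dist_smul₀, Real.norm_of_nonneg hc.le,
    mul_le_mul_iff_right₀ hc]

/-- Both areas in the quotient defining the uniform law scale by the same finite nonzero factor.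
This holds for cells of any area, zero and infinite included. -/
theorem cond_voronoiCell_smul {c : ℝ} (hc : 0 < c) (y : ℕ → Plane) (n : ℕ) (B : Set Plane) :
    ProbabilityTheory.cond volume (voronoiCell (fun m => c • y m) n) B =
      ProbabilityTheory.cond volume (voronoiCell y n) ((fun x : Plane => c • x) ⁻¹' B) := by
  rw [cond_apply (isClosed_voronoiCell _ _).measurableSet,
    cond_apply (isClosed_voronoiCell _ _).measurableSet, ← voronoiCell_smul_preimage hc y n,
    ← preimage_inter, Plane.volume_preimage_smul hc, Plane.volume_preimage_smul hc]
  have h0 : ENNReal.ofReal (c ^ 2)⁻¹ ≠ 0 := by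
    rw [ne_eq, ENNReal.ofReal_eq_zero, not_le]; positivity
  rw [ENNReal.mul_inv (Or.inl h0) (Or.inl ENNReal.ofReal_ne_top), mul_mul_mul_comm,
    ENNReal.inv_mul_cancel h0 ENNReal.ofReal_ne_top, one_mul]

theorem IsCellularNetwork.smul {Ω : Type} [MeasurableSpace Ω] {P : Measure Ω} {lam : ℝ≥0}
    {Y U : ℕ → Ω → Plane} (h : IsCellularNetwork P lam Y U) {c : ℝ} (hc : 0 < c) :
    IsCellularNetwork P (lam * (c ^ 2)⁻¹.toNNReal) (fun n w => c • Y n w)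
      (fun n w => c • U n w) where
  prob := h.prob
  measurable_station n := (h.measurable_station n).const_smul c
  measurable_mobile n := (h.measurable_mobile n).const_smul c
  origin w := by rw [h.origin w, smul_zero]
  injective := by
    filter_upwards [h.injective] with w hw
    exact (smul_right_injective Plane hc.ne').comp hw
  poisson := h.poisson.smul hc
  uniform s B A hB hA := by
    have hm : Measurable (fun x : Plane => c • x) := measurable_const_smul c
    have hA' : MeasurableSet ((fun (y : ℕ → Plane) n => c • y n) ⁻¹' A) :=
      (measurable_pi_lambda _ fun n => hm.comp (measurable_pi_apply n)) hA
    have := h.uniform s (fun n => (fun x : Plane => c • x) ⁻¹' B n) _ (fun n => hm (hB n)) hA'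
    simp_rw [cond_voronoiCell_smul hc]
    exact this

theorem pathGain_smul {c : ℝ} (hc : 0 < c) (α : ℝ) (x : Plane) :
    pathGain α (c • x) = ENNReal.ofReal (c ^ (-α)) * pathGain α x := by
  unfold pathGain
  have h1 : ‖c‖ₑ = ENNReal.ofReal c := Real.enorm_of_nonneg hc.le
  rw [enorm_smul, h1, ← ENNReal.ofReal_rpow_of_pos hc]
  by_cases hx : ‖x‖ₑ = 0
  -- At the origin the gain is `0 ^ (-α)`, which is `∞`, `1` or `0` according to the sign of the
  -- exponent.
  · rcases lt_trichotomy (-α) 0 with ha | ha | ha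
    · rw [hx, mul_zero, ENNReal.zero_rpow_of_neg ha, ENNReal.mul_top]
      rw [ENNReal.ofReal_rpow_of_pos hc, ne_eq, ENNReal.ofReal_eq_zero, not_le]
      positivity
    · simp [ha]
    · rw [ENNReal.mul_rpow_of_nonneg _ _ ha.le]
  · refine ENNReal.mul_rpow_of_ne_zero ?_ hx _
    simpa using hc

theorem uncancelled_smul {c : ℝ} (hc : 0 < c) (K : ℕ) (u : ℕ → Plane) :
    uncancelled K (fun n => c • u n) = uncancelled K u := by
  simp only [uncancelled, norm_smul, Real.norm_of_nonneg hc.le, mul_lt_mul_iff_right₀ hc]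

theorem tsum_uncancelled_smul {c : ℝ} (hc : 0 < c) (α : ℝ) (K : ℕ) (u : ℕ → Plane) :
    ∑' n : uncancelled K (fun n => c • u n), pathGain α (c • u n) =
      ENNReal.ofReal (c ^ (-α)) * ∑' n : uncancelled K u, pathGain α (u n) := by
  rw [uncancelled_smul hc]
  simp only [pathGain_smul hc, ENNReal.tsum_mul_left]

end Scaling

/-! ### Outage after rescaling to unit density -/

section Outage

/-- A point has zero area, hence zero mass under a uniform law. This excludes infinite gain of the
typical mobile, for which the comparison of outage events could fail. -/
theorem IsCellularNetwork.ae_mobile_ne_zero {Ω : Type} [MeasurableSpace Ω] {P : Measure Ω}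
    {lam : ℝ≥0} {Y U : ℕ → Ω → Plane} (h : IsCellularNetwork P lam Y U) (n : ℕ) :
    ∀ᵐ w ∂P, U n w ≠ 0 := by
  have := h.uniform {n} (fun _ => {0}) univ (fun _ => measurableSet_singleton _) .univ
  have h0 : ∀ y : ℕ → Plane,
      (ProbabilityTheory.cond volume (voronoiCell y n)) ({0} : Set Plane) = 0 := fun y =>
    cond_absolutelyContinuous (measure_singleton 0)
  rw [ae_iff]
  simpa [h0] using this

/-- Clearing denominators turns an SINR outage into the event that defines `μ`. Here `b` is the gain
factor of the dilation and `b * s / p` is the rescaled noise. -/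
theorem lt_of_sinr_lt {g I : ℝ≥0∞} {p s θ m b : ℝ} (hp : 0 < p) (hθ : 0 < θ)
    (hb : 0 < b) (hg : g ≠ ∞) (hm : b * s / p ≤ m)
    (h : ENNReal.ofReal p * g / (ENNReal.ofReal p * I + ENNReal.ofReal s) < ENNReal.ofReal θ)
    (hs : 0 < s) :
    ENNReal.ofReal θ⁻¹ * (ENNReal.ofReal b * g) < ENNReal.ofReal b * I + ENNReal.ofReal m := by
  by_cases hI : I = ∞
  · have : ENNReal.ofReal b * I = ∞ := by
      rw [hI, ENNReal.mul_top]; simpa using hb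
    rw [this, top_add, lt_top_iff_ne_top]
    exact ENNReal.mul_ne_top ENNReal.ofReal_ne_top (ENNReal.mul_ne_top ENNReal.ofReal_ne_top hg)
  lift g to ℝ≥0 using hg
  lift I to ℝ≥0 using hI
  rw [ENNReal.div_lt_iff (Or.inl (by simp [hs])) (Or.inl (by finiteness))] at h
  rw [← ENNReal.ofReal_coe_nnreal (p := g), ← ENNReal.ofReal_coe_nnreal (p := I)] at h ⊢
  have hm0 : 0 < m := lt_of_lt_of_le (by positivity) hm
  rw [← ENNReal.ofReal_mul hp.le, ← ENNReal.ofReal_mul hp.le,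
    ← ENNReal.ofReal_add (by positivity) hs.le, ← ENNReal.ofReal_mul hθ.le,
    ENNReal.ofReal_lt_ofReal_iff_of_nonneg (by positivity)] at h
  rw [← ENNReal.ofReal_mul hb.le, ← ENNReal.ofReal_mul hb.le,
    ← ENNReal.ofReal_add (by positivity) hm0.le, ← ENNReal.ofReal_mul (by positivity),
    ENNReal.ofReal_lt_ofReal_iff_of_nonneg (by positivity)]
  calc θ⁻¹ * (b * (g : ℝ)) = b * (p * g) / (θ * p) := by field_simp
    _ < b * (θ * (p * I + s)) / (θ * p) := by gcongr
    _ = b * I + b * s / p := by field_simp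
    _ ≤ _ := by gcongr

theorem outageConstraint_of_le {α θ ε μ σ lamb p : ℝ} {K : ℕ} (hθ : 0 < θ)
    (hσ : 0 < σ) (hlamb : 0 < lamb) (hp : 0 < p) (hμ : IsNoiseThreshold α θ K ε μ)
    (h : σ ^ 2 / (p * lamb ^ (α / 2)) ≤ μ) : OutageConstraint α θ K ε σ lamb p := by
  intro Ω _ P Y U hN
  set c : ℝ := √lamb with hc_def
  have hc : 0 < c := Real.sqrt_pos.2 hlamb
  have hN' : IsCellularNetwork P 1 (fun n w => c • Y n w) (fun n w => c • U n w) := by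
    have := hN.smul hc
    rwa [Real.sq_sqrt hlamb.le, ← Real.toNNReal_mul hlamb.le, mul_inv_cancel₀ hlamb.ne',
      Real.toNNReal_one] at this
  rw [← hμ Ω P _ _ hN']
  refine measure_mono_ae ?_
  filter_upwards [hN.ae_mobile_ne_zero 0] with w hw hlt
  have hlt : sinr α K σ p (fun n => U n w) < ENNReal.ofReal θ := hlt
  rw [sinr, interference, ENNReal.tsum_mul_left] at hlt
  suffices ENNReal.ofReal θ⁻¹ * pathGain α (c • U 0 w) <
      (∑' n : uncancelled K (fun n => c • U n w), pathGain α (c • U n w)) + ENNReal.ofReal μ from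
    this
  rw [tsum_uncancelled_smul hc, pathGain_smul hc]
  refine lt_of_sinr_lt hp hθ (by positivity) ?_ (le_trans (le_of_eq ?_) h) hlt (by positivity)
  · unfold pathGain
    simp [ENNReal.rpow_eq_top_iff, hw]
  · have : c ^ (-α) = (lamb ^ (α / 2))⁻¹ := by
      rw [hc_def, Real.sqrt_eq_rpow, ← Real.rpow_mul hlamb.le, ← Real.rpow_neg hlamb.le]
      congr 1; ring
    rw [this]
    field_simp

end Outage

/-! ### Frequencies of pairwise independent events -/

section LawOfLargeNumbers

variable {Ω : Type} [MeasurableSpace Ω] {P : Measure Ω}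

theorem IndepSet.indepFun_indicator {E F : Set Ω} (h : IndepSet E F P) :
    E.indicator (fun _ => (1 : ℝ)) ⟂ᵢ[P] F.indicator (fun _ => (1 : ℝ)) := by
  have key : ∀ G : Set Ω, MeasurableSpace.comap (G.indicator fun _ => (1 : ℝ)) inferInstance ≤
      MeasurableSpace.generateFrom {G} := fun G =>
    Measurable.comap_le (Measurable.indicator measurable_const
      (MeasurableSpace.measurableSet_generateFrom (mem_singleton G)))
  exact indep_of_indep_of_le_left (indep_of_indep_of_le_right h (key F)) (key E)

theorem identDistrib_indicator_one {E F : Set Ω} (hE : MeasurableSet E) (hF : MeasurableSet F)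
    [IsFiniteMeasure P] (h : P E = P F) :
    IdentDistrib (E.indicator fun _ => (1 : ℝ)) (F.indicator fun _ => (1 : ℝ)) P P := by
  refine ⟨(measurable_const.indicator hE).aemeasurable,
    (measurable_const.indicator hF).aemeasurable, ?_⟩
  ext s hs
  rw [Measure.map_apply (measurable_const.indicator hE) hs,
    Measure.map_apply (measurable_const.indicator hF) hs]
  have hc : P Eᶜ = P Fᶜ := by
    rw [measure_compl hE (measure_ne_top _ _), measure_compl hF (measure_ne_top _ _), h]
  classical
  rw [indicator_const_preimage_eq_union, indicator_const_preimage_eq_union]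
  by_cases h1 : (1 : ℝ) ∈ s <;> by_cases h0 : (0 : ℝ) ∈ s <;> simp [h1, h0, h, hc]

/-- Strong law of large numbers for the frequencies of pairwise independent events. -/
theorem ae_tendsto_frequency [IsProbabilityMeasure P] {E : ℕ → Set Ω} {c : ℝ} (hc : 0 ≤ c)
    (hE : ∀ n, MeasurableSet (E n)) (hP : ∀ n, P (E n) = ENNReal.ofReal c)
    (hi : ∀ i j, i ≠ j → P (E i ∩ E j) = P (E i) * P (E j)) :
    ∀ᵐ w ∂P, Tendsto (fun n : ℕ =>
      (∑ i ∈ Finset.range n, (E i).indicator (fun _ => (1 : ℝ)) w) / n) atTop (𝓝 c) := by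
  have h := strong_law_ae_real (μ := P) (fun i => (E i).indicator fun _ => (1 : ℝ))
    ((integrable_const 1).indicator (hE 0))
    (fun i j hij => IndepSet.indepFun_indicator
      ((indepSet_iff_measure_inter_eq_mul (hE i) (hE j) P).2 (hi i j hij)))
    (fun i => identDistrib_indicator_one (hE i) (hE 0) (by rw [hP, hP]))
  have : ∫ w, (E 0).indicator (fun _ => (1 : ℝ)) w ∂P = c := by
    rw [integral_indicator_const _ (hE 0), measureReal_def, hP, ENNReal.toReal_ofReal hc]
    simp
  rwa [this] at h

end LawOfLargeNumbers

/-! ### Beacons near a moving mobile -/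

section Beacons

variable {Ω : Type} {m : MeasurableSpace Ω} [mΩ : MeasurableSpace Ω] {P : Measure Ω} {lam : ℝ≥0}
  {Ψ : Ω → Set Plane}

theorem IsPoissonProcess.measure_count_ball_ne_zero [IsProbabilityMeasure P]
    (h : IsPoissonProcess P lam Ψ) (x : Plane) {ρ : ℝ} (hρ : 0 ≤ ρ) :
    P {w | pointCount Ψ (Metric.ball x ρ) w ≠ 0} =
      ENNReal.ofReal (1 - Real.exp (-(Real.pi * lam * ρ ^ 2))) := by
  have hm := h.measurable_count _ (measurableSet_ball (x := x) (ε := ρ))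
  have hz : P {w | pointCount Ψ (Metric.ball x ρ) w = 0} =
      ENNReal.ofReal (Real.exp (-(Real.pi * lam * ρ ^ 2))) := by
    have hv : volume (Metric.ball x ρ) = ENNReal.ofReal (ρ ^ 2 * Real.pi) := by
      rw [EuclideanSpace.volume_ball_fin_two, ← ENNReal.ofReal_pow hρ,
        ← ENNReal.ofReal_mul (by positivity)]
    have h1 : P {w | pointCount Ψ (Metric.ball x ρ) w = 0} =
        P.map (pointCount Ψ (Metric.ball x ρ)) {0} :=
      (Measure.map_apply hm (measurableSet_singleton _)).symm
    have h2 : (Nat.cast : ℕ → ℕ∞) ⁻¹' {0} = {0} := by ext; simp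
    rw [h1, h.law_count _ measurableSet_ball measure_ball_lt_top.ne,
      Measure.map_apply (measurable_of_countable _) (measurableSet_singleton _), h2,
      poissonMeasure_singleton, hv]
    simp only [pow_zero, mul_one, Nat.factorial_zero, Nat.cast_one,
      div_one, NNReal.coe_mul]
    have : ((ENNReal.ofReal (ρ ^ 2 * Real.pi)).toNNReal : ℝ) = ρ ^ 2 * Real.pi :=
      ENNReal.toReal_ofReal (by positivity)
    rw [this]
    congr 2
    ring
  have hs : {w | pointCount Ψ (Metric.ball x ρ) w ≠ 0} =
      {w | pointCount Ψ (Metric.ball x ρ) w = 0}ᶜ := rfl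
  have hms : MeasurableSet {w | pointCount Ψ (Metric.ball x ρ) w = 0} :=
    hm (measurableSet_singleton 0)
  rw [hs, prob_compl_eq_one_sub hms, hz,
    ENNReal.ofReal_sub _ (Real.exp_pos _).le, ENNReal.ofReal_one]

/-- Local finiteness guarantees that a nearest beacon exists; without one, no beacon would receive
the main-lobe response. -/
theorem IsPoissonProcess.ae_finite_inter_ball [IsProbabilityMeasure P]
    (h : IsPoissonProcess P lam Ψ) : ∀ᵐ w ∂P, ∀ n : ℕ, (Ψ w ∩ Metric.ball 0 n).Finite := by
  rw [ae_all_iff]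
  intro n
  have hm := h.measurable_count _ (measurableSet_ball (x := (0 : Plane)) (ε := n))
  have hz : P.map (pointCount Ψ (Metric.ball 0 n)) {⊤} = 0 := by
    have h2 : (Nat.cast : ℕ → ℕ∞) ⁻¹' {⊤} = ∅ := by ext; simp
    rw [h.law_count _ measurableSet_ball measure_ball_lt_top.ne,
      Measure.map_apply (measurable_of_countable _) (measurableSet_singleton _), h2,
      measure_empty]
  rw [Measure.map_apply hm (measurableSet_singleton _)] at hz
  rw [ae_iff]
  convert hz using 2
  ext w
  exact Set.encard_eq_top_iff.symm

/-- A countable partition of the plane into sets of radius at most `δ`. -/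
noncomputable def gridCell (δ : ℝ) (k : ℕ) : Set Plane :=
  disjointed (fun j => Metric.ball (TopologicalSpace.denseSeq Plane j) δ) k

theorem measurableSet_gridCell (δ : ℝ) (k : ℕ) : MeasurableSet (gridCell δ k) :=
  MeasurableSet.disjointed (fun _ => measurableSet_ball) k

theorem dist_lt_of_mem_gridCell {δ : ℝ} {k : ℕ} {x : Plane} (h : x ∈ gridCell δ k) :
    dist x (TopologicalSpace.denseSeq Plane k) < δ :=
  disjointed_subset _ k h

theorem pairwise_disjoint_gridCell (δ : ℝ) :
    Pairwise (fun i j => Disjoint (gridCell δ i) (gridCell δ j)) :=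
  disjoint_disjointed _

theorem iUnion_gridCell {δ : ℝ} (hδ : 0 < δ) : ⋃ k, gridCell δ k = univ := by
  unfold gridCell
  rw [iUnion_disjointed, eq_univ_iff_forall]
  intro x
  obtain ⟨k, hk⟩ := (TopologicalSpace.denseRange_denseSeq Plane).exists_dist_lt x hδ
  exact mem_iUnion.2 ⟨k, hk⟩

/-- The event that a beacon lies within `ρ` of the grid point that represents the position `X`. -/
noncomputable def nearBeacon (Ψ : Ω → Set Plane) (X : Ω → Plane) (δ ρ : ℝ) : Set Ω :=
  ⋃ k, {w | pointCount Ψ (Metric.ball (TopologicalSpace.denseSeq Plane k) ρ) w ≠ 0} ∩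
    X ⁻¹' gridCell δ k

theorem exists_beacon_of_mem_nearBeacon {Ω : Type} {Ψ : Ω → Set Plane} {X : Ω → Plane} {δ ρ : ℝ} {w : Ω}
    (h : w ∈ nearBeacon Ψ X δ ρ) : ∃ T ∈ Ψ w, dist (X w) T < δ + ρ := by
  obtain ⟨k, hk, hX⟩ := mem_iUnion.1 h
  obtain ⟨T, hT, hd⟩ := encard_ne_zero.1 hk
  refine ⟨T, hT, ?_⟩
  have h1 := dist_lt_of_mem_gridCell hX
  rw [Metric.mem_ball'] at hd
  linarith [dist_triangle (X w) (TopologicalSpace.denseSeq Plane k) T]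

theorem measurableSet_count_ball_ne_zero {Ω : Type} (Ψ : Ω → Set Plane) (x : Plane) (ρ : ℝ) :
    MeasurableSet[pointSigma Ψ] {w | pointCount Ψ (Metric.ball x ρ) w ≠ 0} := by
  refine le_iSup (fun B : {B : Set Plane // MeasurableSet B} =>
    MeasurableSpace.comap (pointCount Ψ B.1) inferInstance)
    ⟨Metric.ball x ρ, measurableSet_ball⟩ _ ?_
  exact ⟨{0}ᶜ, (measurableSet_singleton _).compl, rfl⟩

theorem measurableSet_nearBeacon {Ω : Type} {m : MeasurableSpace Ω} {Ψ : Ω → Set Plane}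
    {X : Ω → Plane} (hΨ : pointSigma Ψ ≤ m)
    (hX : Measurable[m] X) (δ ρ : ℝ) : MeasurableSet[m] (nearBeacon Ψ X δ ρ) :=
  MeasurableSet.iUnion fun k => (hΨ _ (measurableSet_count_ball_ne_zero Ψ _ ρ)).inter
    (hX (measurableSet_gridCell δ k))

theorem IsPoissonProcess.pointSigma_le (h : IsPoissonProcess P lam Ψ) :
    pointSigma Ψ ≤ mΩ :=
  iSup_le fun B => (h.measurable_count B.1 B.2).comap_le

/-- By stationarity, the event `nearBeacon` is independent of all that is independent of the
beacons, the position included. -/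
theorem IsPoissonProcess.measure_nearBeacon_inter [IsProbabilityMeasure P]
    (h : IsPoissonProcess P lam Ψ) {X : Ω → Plane}
    (hm : m ≤ mΩ)
    (hX : Measurable[m] X) (hind : Indep (pointSigma Ψ) m P) {δ ρ : ℝ} (hδ : 0 < δ) (hρ : 0 ≤ ρ)
    {F : Set Ω} (hF : MeasurableSet[m] F) :
    P (nearBeacon Ψ X δ ρ ∩ F) =
      ENNReal.ofReal (1 - Real.exp (-(Real.pi * lam * ρ ^ 2))) * P F := by
  have hXF : ∀ k, MeasurableSet[m] (X ⁻¹' gridCell δ k ∩ F) := fun k =>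
    (hX (measurableSet_gridCell δ k)).inter hF
  have hdisj : Pairwise (fun i j => Disjoint (X ⁻¹' gridCell δ i ∩ F) (X ⁻¹' gridCell δ j ∩ F)) :=
    fun i j hij => ((pairwise_disjoint_gridCell δ hij).preimage X).mono inter_subset_left
      inter_subset_left
  have hF' : P F = ∑' k, P (X ⁻¹' gridCell δ k ∩ F) := by
    rw [← measure_iUnion hdisj (fun k => hm _ (hXF k)), ← iUnion_inter, ← preimage_iUnion,
      iUnion_gridCell hδ, preimage_univ, univ_inter]
  rw [nearBeacon, iUnion_inter]
  simp only [inter_assoc]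
  rw [measure_iUnion (fun i j hij => (hdisj hij).mono inter_subset_right inter_subset_right)
    (fun k => (h.pointSigma_le _ (measurableSet_count_ball_ne_zero Ψ _ ρ)).inter (hm _ (hXF k))),
    hF', ← ENNReal.tsum_mul_left]
  refine tsum_congr fun k => ?_
  -- Within one cell the ball has a fixed centre, so independence applies, and the void probability
  -- does not depend on the centre.
  rw [Indep_iff] at hind
  rw [hind _ _ (measurableSet_count_ball_ne_zero Ψ _ ρ) (hXF k), h.measure_count_ball_ne_zero _ hρ]

/-- The nearest beacon is at least as close as `T` and has the main-lobe response; all side-lobe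
contributions are discarded. -/
theorem le_directedPower {β ν zm zs q : ℝ} {S : Set Plane} (hβ : 0 ≤ β) (hν : 0 < ν)
    (hzm : 0 ≤ zm) (hq : 0 ≤ q) (hS : ∀ n : ℕ, (S ∩ Metric.ball 0 n).Finite) {x T : Plane}
    {r : ℝ} (hT : T ∈ S) (hr : dist x T < r) :
    ENNReal.ofReal (zm * q * (max r ν) ^ (-β)) ≤ directedPower β ν zm zs q S x := by
  have hfin : (S ∩ Metric.ball x r).Finite := by
    obtain ⟨n, hn⟩ := exists_nat_ge (r + dist x 0)
    exact (hS n).subset (inter_subset_inter_right _ (Metric.ball_subset_ball' hn))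
  obtain ⟨T₀, ⟨hT₀, hd₀⟩, hmin⟩ := Set.exists_min_image _ (fun T => dist x T) hfin
    ⟨T, hT, Metric.mem_ball'.2 hr⟩
  rw [Metric.mem_ball'] at hd₀
  have hnear : ∀ T' ∈ S, dist x T₀ ≤ dist x T' := by
    intro T' hT'
    by_cases hb : dist x T' < r
    · exact hmin T' ⟨hT', Metric.mem_ball'.2 hb⟩
    · exact hd₀.le.trans (not_lt.1 hb)
  unfold directedPower
  refine le_trans ?_ (ENNReal.le_tsum ⟨T₀, hT₀⟩)
  rw [if_pos hnear]
  refine ENNReal.ofReal_le_ofReal (mul_le_mul_of_nonneg_left ?_ (by positivity))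
  exact Real.rpow_le_rpow_of_nonpos (lt_max_of_lt_right hν) (max_le_max hd₀.le le_rfl)
    (by linarith)

end Beacons

/-! ### Energy balance with infinite storage -/

section Storage

open scoped Classical in
/-- The energy spent in a slot is at most `p`, and only if there is a packet. -/
theorem sum_harvest_le_storedEnergy_add {Ω : Type} {p : ℝ} (hp : 0 ≤ p) (A : ℕ → Set Ω)
    (H : ℕ → Ω → ℝ≥0∞) (t : ℕ) (w : Ω) :
    ∑ i ∈ Finset.range t, H i w ≤ storedEnergy p A H t w +
      ENNReal.ofReal (p * ∑ i ∈ Finset.range t, (A i).indicator (fun _ => (1 : ℝ)) w) := by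
  induction t with
  | zero => simp
  | succ t ih =>
    rw [Finset.sum_range_succ, Finset.sum_range_succ, mul_add, ENNReal.ofReal_add
      (mul_nonneg hp (Finset.sum_nonneg fun i _ => indicator_nonneg (fun _ _ => zero_le_one) _))
      (mul_nonneg hp (indicator_nonneg (fun _ _ => zero_le_one) _)), storedEnergy]
    set S := storedEnergy p A H t w
    set a := ENNReal.ofReal (p * ∑ i ∈ Finset.range t, (A i).indicator (fun _ => (1 : ℝ)) w)
    set c := if w ∈ A t ∧ ENNReal.ofReal p ≤ S then ENNReal.ofReal p else 0 with hc
    have hca : c ≤ ENNReal.ofReal (p * (A t).indicator (fun _ => (1 : ℝ)) w) := by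
      rw [hc]
      split_ifs with h
      · simp [h.1]
      · exact zero_le
    calc _ ≤ S + a + H t w := by gcongr
      _ ≤ (S - c + c) + a + H t w := by gcongr; exact le_tsub_add
      _ ≤ (S - c + ENNReal.ofReal (p * (A t).indicator (fun _ => (1 : ℝ)) w)) + a + H t w := by
        gcongr
      _ = _ := by ring

/-- Sustainability when the harvest dominates two gain levels reached with given frequencies. -/
theorem tendsto_measure_storedEnergy {Ω : Type} [MeasurableSpace Ω] {P : Measure Ω}
    [IsProbabilityMeasure P] {p dc g₁ g₂ c₁ c₂ : ℝ} {A E₁ E₂ : ℕ → Set Ω} {H : ℕ → Ω → ℝ≥0∞}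
    (hp : 0 < p) (hg₁ : 0 ≤ g₁) (hg₂ : 0 ≤ g₂)
    (hA : ∀ n, MeasurableSet (A n)) (hE₁ : ∀ n, MeasurableSet (E₁ n))
    (hE₂ : ∀ n, MeasurableSet (E₂ n))
    (hAf : ∀ᵐ w ∂P, Tendsto (fun n : ℕ =>
      (∑ i ∈ Finset.range n, (A i).indicator (fun _ => (1 : ℝ)) w) / n) atTop (𝓝 dc))
    (hE₁f : ∀ᵐ w ∂P, Tendsto (fun n : ℕ =>
      (∑ i ∈ Finset.range n, (E₁ i).indicator (fun _ => (1 : ℝ)) w) / n) atTop (𝓝 c₁))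
    (hE₂f : ∀ᵐ w ∂P, Tendsto (fun n : ℕ =>
      (∑ i ∈ Finset.range n, (E₂ i).indicator (fun _ => (1 : ℝ)) w) / n) atTop (𝓝 c₂))
    (hH : ∀ᵐ w ∂P, ∀ n, ENNReal.ofReal (g₁ * (E₁ n).indicator (fun _ => (1 : ℝ)) w +
      g₂ * (E₂ n).indicator (fun _ => (1 : ℝ)) w) ≤ H n w)
    (hdrift : p * dc < g₁ * c₁ + g₂ * c₂) :
    Tendsto (fun t => P {w | ENNReal.ofReal p ≤ storedEnergy p A H t w}) atTop (𝓝 1) := by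
  set a : ℕ → Ω → ℝ := fun n w => ∑ i ∈ Finset.range n, (A i).indicator (fun _ => (1 : ℝ)) w
  set e₁ : ℕ → Ω → ℝ := fun n w => ∑ i ∈ Finset.range n, (E₁ i).indicator (fun _ => (1 : ℝ)) w
  set e₂ : ℕ → Ω → ℝ := fun n w => ∑ i ∈ Finset.range n, (E₂ i).indicator (fun _ => (1 : ℝ)) w
  have hnn : ∀ (E : Set Ω) w, 0 ≤ E.indicator (fun _ => (1 : ℝ)) w := fun E w =>
    indicator_nonneg (fun _ _ => zero_le_one) _
  have hmeas : ∀ E : ℕ → Set Ω, (∀ n, MeasurableSet (E n)) → ∀ n, Measurable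
      (fun w => ∑ i ∈ Finset.range n, (E i).indicator (fun _ => (1 : ℝ)) w) := fun E hE n =>
    Finset.measurable_sum _ fun i _ => measurable_const.indicator (hE i)
  -- On `M n` the guaranteed harvest covers the demand of all packets so far and leaves one further
  -- `p` in store. The extra `p` vanishes after division by `n`.
  set M : ℕ → Set Ω := fun n => {w | p + p * a n w ≤ g₁ * e₁ n w + g₂ * e₂ n w} with hM
  have hMm : ∀ n, MeasurableSet (M n) := fun n =>
    measurableSet_le (((hmeas A hA n).const_mul p).const_add p)
      (((hmeas E₁ hE₁ n).const_mul g₁).add ((hmeas E₂ hE₂ n).const_mul g₂))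
  have hMev : ∀ᵐ w ∂P, ∀ᶠ n in atTop, w ∈ M n := by
    filter_upwards [hAf, hE₁f, hE₂f] with w h0 h1 h2
    have hlim : Tendsto (fun n : ℕ => p / n + p * (a n w / n)) atTop (𝓝 (0 + p * dc)) :=
      (tendsto_const_div_atTop_nhds_zero_nat p).add (h0.const_mul p)
    have hlim' : Tendsto (fun n : ℕ => g₁ * (e₁ n w / n) + g₂ * (e₂ n w / n)) atTop
      (𝓝 (g₁ * c₁ + g₂ * c₂)) := (h1.const_mul g₁).add (h2.const_mul g₂)
    filter_upwards [hlim.eventually_lt hlim' (by linarith), eventually_gt_atTop 0] with n hn hn0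
    have hn0' : (0 : ℝ) < n := by exact_mod_cast hn0
    have := mul_lt_mul_of_pos_right hn hn0'
    have l : (p / n + p * (a n w / n)) * n = p + p * a n w := by field_simp
    have r : (g₁ * (e₁ n w / n) + g₂ * (e₂ n w / n)) * n = g₁ * e₁ n w + g₂ * e₂ n w := by
      field_simp
    rw [l, r] at this
    exact this.le
  have hMlim : Tendsto (fun n => P (M n)) atTop (𝓝 1) := by
    have := tendsto_measure_of_ae_tendsto_indicator_of_isFiniteMeasure (μ := P) (A := univ)
      atTop MeasurableSet.univ hMm (hMev.mono fun w hw => by simpa using hw)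
    simpa using this
  refine tendsto_of_tendsto_of_tendsto_of_le_of_le hMlim tendsto_const_nhds
    (fun n => measure_mono_ae ?_) (fun n => prob_le_one)
  filter_upwards [hH] with w hw hwM
  have hwM : p + p * a n w ≤ g₁ * e₁ n w + g₂ * e₂ n w := hwM
  suffices ENNReal.ofReal p ≤ storedEnergy p A H n w from this
  have ha : 0 ≤ p * a n w := mul_nonneg hp.le (Finset.sum_nonneg fun i _ => hnn _ _)
  -- Adding the finite demand to both sides avoids truncated subtraction.
  refine ENNReal.le_of_add_le_add_right (a := ENNReal.ofReal (p * a n w)) ENNReal.ofReal_ne_top ?_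
  refine le_trans ?_ (sum_harvest_le_storedEnergy_add hp.le A H n w)
  rw [← ENNReal.ofReal_add hp.le ha]
  refine (ENNReal.ofReal_le_ofReal hwM).trans ?_
  have : g₁ * e₁ n w + g₂ * e₂ n w = ∑ i ∈ Finset.range n,
      (g₁ * (E₁ i).indicator (fun _ => (1 : ℝ)) w + g₂ * (E₂ i).indicator (fun _ => (1 : ℝ)) w) := by
    rw [Finset.sum_add_distrib, Finset.mul_sum, Finset.mul_sum]
  rw [this, ENNReal.ofReal_sum_of_nonneg fun i _ =>
    add_nonneg (mul_nonneg hg₁ (hnn _ _)) (mul_nonneg hg₂ (hnn _ _))]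
  exact Finset.sum_le_sum fun i _ => hw i

end Storage

/-! ### Sustainable power under directed transfer -/

section Charging

/-- The positions of different slots may be dependent. Since the beacons of slot `i` are independent
of those of slot `j` jointly with the whole trajectory, the events of different slots are still
pairwise independent. -/
theorem IsChargingModel.ae_tendsto_nearBeacon {Ω : Type} [mΩ : MeasurableSpace Ω] {P : Measure Ω}
    {lam : ℝ≥0} {dc : ℝ} {Ψ : ℕ → Ω → Set Plane} {X : ℕ → Ω → Plane} {A : ℕ → Set Ω}
    (h : IsChargingModel P lam dc Ψ X A) {δ ρ : ℝ} (hδ : 0 < δ) (hρ : 0 ≤ ρ) :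
    ∀ᵐ w ∂P, Tendsto (fun n : ℕ => (∑ i ∈ Finset.range n,
      (nearBeacon (Ψ i) (X i) δ ρ).indicator (fun _ => (1 : ℝ)) w) / n) atTop
      (𝓝 (1 - Real.exp (-(Real.pi * lam * ρ ^ 2)))) := by
  have := h.prob
  have hX : (⨆ t, MeasurableSpace.comap (X t) inferInstance) ≤ mΩ :=
    iSup_le fun t => (h.measurable_position t).comap_le
  have hXm : ∀ i, Measurable[⨆ t, MeasurableSpace.comap (X t) inferInstance] (X i) := fun i =>
    Measurable.of_comap_le (le_iSup (fun t => MeasurableSpace.comap (X t) inferInstance) i)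
  have hm : ∀ i, MeasurableSet (nearBeacon (Ψ i) (X i) δ ρ) := fun i =>
    measurableSet_nearBeacon (h.poisson i).pointSigma_le (h.measurable_position i) δ ρ
  have key : ∀ i j, i ≠ j → Indep (pointSigma (Ψ i))
      (pointSigma (Ψ j) ⊔ ⨆ t, MeasurableSpace.comap (X t) inferInstance) P := by
    intro i j hij
    have hall := indep_iSup_of_disjoint (m := Sum.elim (fun t => pointSigma (Ψ t))
      (Sum.elim (fun t => MeasurableSpace.generateFrom {A t})
        (fun _ : Unit => ⨆ t, MeasurableSpace.comap (X t) inferInstance)))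
      (S := {Sum.inl i}) (T := {Sum.inl j, Sum.inr (Sum.inr ())}) (μ := P) (_mΩ := mΩ) ?_ h.indep
      (by simp [hij])
    · rw [iSup_singleton, iSup_pair] at hall
      exact hall
    · rintro (t | t | t)
      · exact (h.poisson t).pointSigma_le
      · exact MeasurableSpace.generateFrom_le (by simpa using h.measurable_active t)
      · exact hX
  have hinter : ∀ i j, i ≠ j → ∀ F, MeasurableSet[pointSigma (Ψ j) ⊔
      ⨆ t, MeasurableSpace.comap (X t) inferInstance] F →
      P (nearBeacon (Ψ i) (X i) δ ρ ∩ F) =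
        ENNReal.ofReal (1 - Real.exp (-(Real.pi * lam * ρ ^ 2))) * P F := by
    intro i j hij F hF
    exact (h.poisson i).measure_nearBeacon_inter (sup_le (h.poisson j).pointSigma_le hX)
      ((hXm i).mono le_sup_right le_rfl) (key i j hij) hδ hρ hF
  have hP : ∀ i, P (nearBeacon (Ψ i) (X i) δ ρ) =
      ENNReal.ofReal (1 - Real.exp (-(Real.pi * lam * ρ ^ 2))) := by
    intro i
    have := hinter i (i + 1) (by omega) univ MeasurableSet.univ
    rwa [inter_univ, measure_univ, mul_one] at this
  refine ae_tendsto_frequency ?_ hm hP fun i j hij => ?_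
  · rw [sub_nonneg, Real.exp_le_one_iff, neg_nonpos]
    positivity
  · rw [hP i]
    exact hinter i j hij _ (measurableSet_nearBeacon le_sup_left
      ((hXm j).mono le_sup_right le_rfl) δ ρ)

theorem IsChargingModel.ae_tendsto_active {Ω : Type} [mΩ : MeasurableSpace Ω] {P : Measure Ω}
    {lam : ℝ≥0} {dc : ℝ} {Ψ : ℕ → Ω → Set Plane} {X : ℕ → Ω → Plane} {A : ℕ → Set Ω}
    (h : IsChargingModel P lam dc Ψ X A) (hdc : 0 ≤ dc) :
    ∀ᵐ w ∂P, Tendsto (fun n : ℕ => (∑ i ∈ Finset.range n,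
      (A i).indicator (fun _ => (1 : ℝ)) w) / n) atTop (𝓝 dc) := by
  have := h.prob
  refine ae_tendsto_frequency hdc h.measurable_active h.prob_active fun i j hij => ?_
  have hij' : (Sum.inr (Sum.inl i) : ℕ ⊕ ℕ ⊕ Unit) ≠ Sum.inr (Sum.inl j) := by simpa using hij
  have := h.indep.indep hij'
  rw [Indep_iff] at this
  exact this _ _ (MeasurableSpace.measurableSet_generateFrom (mem_singleton _))
    (MeasurableSpace.measurableSet_generateFrom (mem_singleton _))

/-- The harvest is bounded below by a step function with levels `G` within `ν` and `b * G` within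
`2ν`, written as `G * (1-b)` on one event plus `G * b` on the other. Replacing the position by a
grid point costs `η * ν`, so the radii shrink to `(1-η)ν` and `(2-η)ν`. -/
theorem directedSustainable_of_lt {β ν dc zm zs q lamp p b η : ℝ} (hβ : 0 < β) (hν : 0 < ν)
    (hdc : 0 ≤ dc) (hzm : 0 ≤ zm) (hq : 0 ≤ q) (hlamp : 0 ≤ lamp) (hp : 0 < p)
    (hb : b = 2 ^ (-β)) (hη : 0 < η) (hη1 : η < 1)
    (hdrift : p * dc < zm * q * ν ^ (-β) *
      (1 - (1 - b) * Real.exp (-(Real.pi * ν ^ 2 * lamp * (1 - η) ^ 2)) -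
        b * Real.exp (-(Real.pi * ν ^ 2 * lamp * (2 - η) ^ 2)))) :
    DirectedSustainable β ν dc zm zs q lamp p := by
  intro Ω _ P Ψ X A hM
  have := hM.prob
  have hb0 : 0 < b := by rw [hb]; positivity
  have hb1 : b ≤ 1 := by
    rw [hb]; exact Real.rpow_le_one_of_one_le_of_nonpos one_le_two (by linarith)
  have hG : 0 ≤ zm * q * ν ^ (-β) := by positivity
  have hδ : 0 < η * ν := by positivity
  have hρ₁ : 0 ≤ (1 - η) * ν := mul_nonneg (by linarith) hν.le
  have hρ₂ : 0 ≤ (2 - η) * ν := mul_nonneg (by linarith) hν.le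
  refine tendsto_measure_storedEnergy (g₁ := zm * q * ν ^ (-β) * (1 - b))
    (g₂ := zm * q * ν ^ (-β) * b)
    (E₁ := fun t => nearBeacon (Ψ t) (X t) (η * ν) ((1 - η) * ν))
    (E₂ := fun t => nearBeacon (Ψ t) (X t) (η * ν) ((2 - η) * ν))
    hp (mul_nonneg hG (by linarith)) (mul_nonneg hG hb0.le) hM.measurable_active
    (fun t => measurableSet_nearBeacon (hM.poisson t).pointSigma_le (hM.measurable_position t) _ _)
    (fun t => measurableSet_nearBeacon (hM.poisson t).pointSigma_le (hM.measurable_position t) _ _)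
    (hM.ae_tendsto_active hdc) (hM.ae_tendsto_nearBeacon hδ hρ₁) (hM.ae_tendsto_nearBeacon hδ hρ₂)
    ?_ ?_
  · have hfin : ∀ᵐ w ∂P, ∀ t, ∀ n : ℕ, (Ψ t w ∩ Metric.ball 0 n).Finite :=
      ae_all_iff.2 fun t => (hM.poisson t).ae_finite_inter_ball
    filter_upwards [hfin] with w hw t
    have hind : ∀ E : Set Ω, E.indicator (fun _ => (1 : ℝ)) w ≤ 1 := fun E =>
      indicator_le_self' (fun _ _ => zero_le_one) w
    by_cases h1 : w ∈ nearBeacon (Ψ t) (X t) (η * ν) ((1 - η) * ν)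
    · obtain ⟨T, hT, hd⟩ := exists_beacon_of_mem_nearBeacon h1
      have hd' : dist (X t w) T < ν := by linarith
      refine le_trans (ENNReal.ofReal_le_ofReal ?_)
        (le_directedPower (zs := zs) hβ.le hν hzm hq (hw t) hT hd')
      rw [max_self]
      -- Whether or not the second event occurs too, the two weighted indicators add up to at most
      -- `G * (1-b) + G * b = G`.
      have e1 := mul_le_mul_of_nonneg_left
        (hind (nearBeacon (Ψ t) (X t) (η * ν) ((1 - η) * ν))) (mul_nonneg hG (sub_nonneg.2 hb1))
      have e2 := mul_le_mul_of_nonneg_left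
        (hind (nearBeacon (Ψ t) (X t) (η * ν) ((2 - η) * ν))) (mul_nonneg hG hb0.le)
      linarith
    · rw [indicator_of_notMem h1]
      by_cases h2 : w ∈ nearBeacon (Ψ t) (X t) (η * ν) ((2 - η) * ν)
      · obtain ⟨T, hT, hd⟩ := exists_beacon_of_mem_nearBeacon h2
        have hd' : dist (X t w) T < 2 * ν := by linarith
        refine le_trans (ENNReal.ofReal_le_ofReal ?_)
          (le_directedPower (zs := zs) hβ.le hν hzm hq (hw t) hT hd')
        rw [max_eq_left (by linarith), Real.mul_rpow zero_le_two hν.le, ← hb,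
          indicator_of_mem h2]
        linarith
      · rw [indicator_of_notMem h2]
        simp
  · have hc : (lamp.toNNReal : ℝ) = lamp := Real.coe_toNNReal _ hlamp
    rw [hc]
    refine lt_of_lt_of_le hdrift (le_of_eq ?_)
    have e1 : Real.pi * lamp * ((1 - η) * ν) ^ 2 = Real.pi * ν ^ 2 * lamp * (1 - η) ^ 2 := by ring
    have e2 : Real.pi * lamp * ((2 - η) * ν) ^ 2 = Real.pi * ν ^ 2 * lamp * (2 - η) ^ 2 := by ring
    rw [e1, e2]
    ring

end Charging

/-! ### Harvest against its linear approximation -/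

section Drift

/-- A beacon at distance between `ν` and `2 * ν` still contributes, so for sparse beacons the mean
harvest exceeds the linear approximation of the probability of a beacon within `ν`. -/
theorem exists_forall_lt_harvest {b η : ℝ} (hb : 0 < b) (hb1 : b < 1 / 4) (hη : η = b / 2) :
    ∃ a₀ : ℝ, 0 < a₀ ∧ ∀ x a : ℝ, 0 < x → x ≤ a₀ → x ≤ a →
      x < 1 - (1 - b) * Real.exp (-(a * (1 - η) ^ 2)) - b * Real.exp (-(a * (2 - η) ^ 2)) := by
  -- `L` is the slope of the harvest at `0`. It would be `1 + 3b` without the grid error `η`; with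
  -- `η = b/2` it is `1 + 2b - 3b²/4`, still above `1`.
  set L : ℝ := (1 - b) * (1 - η) ^ 2 + b * (2 - η) ^ 2 with hL
  have hL1 : 1 < L := by rw [hL, hη]; nlinarith
  set f : ℝ → ℝ := fun a =>
    1 - (1 - b) * Real.exp (-(a * (1 - η) ^ 2)) - b * Real.exp (-(a * (2 - η) ^ 2)) with hf
  have hexp : ∀ k : ℝ, HasDerivAt (fun a : ℝ => Real.exp (-(a * k))) (-k) 0 := by
    intro k
    have := ((hasDerivAt_id (0 : ℝ)).mul_const k).neg.exp
    simpa using this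
  have hd : HasDerivAt f L 0 := by
    have := (((hexp ((1 - η) ^ 2)).const_mul (1 - b)).const_sub 1).sub
      ((hexp ((2 - η) ^ 2)).const_mul b)
    have hL' : -((1 - b) * -(1 - η) ^ 2) - b * -(2 - η) ^ 2 = L := by rw [hL]; ring
    rw [hL'] at this
    exact this
  have hslope := hd.hasDerivWithinAt (s := Ioi 0)
  rw [hasDerivWithinAt_iff_tendsto_slope' (by simp)] at hslope
  have hev := hslope.eventually_const_lt hL1
  obtain ⟨c, hc, hcs⟩ := (mem_nhdsGT_iff_exists_Ioc_subset).1 hev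
  refine ⟨c, hc, fun x a hx hxc hxa => ?_⟩
  have h1 : 1 < slope f 0 x := hcs ⟨hx, hxc⟩
  have hf0 : f 0 = 0 := by simp [hf]
  rw [slope_def_field, hf0, sub_zero, sub_zero, one_lt_div hx] at h1
  -- The harvest increases with the beacon density, so only `x`, and not `a`, has to be small.
  refine h1.trans_le ?_
  simp only [hf]
  gcongr
  linarith

end Drift

/-! ### Choice of error function, threshold and power -/

theorem corollary1 (α β ν dc θ ε μ : ℝ) (K : ℕ) (hα : 2 < α) (hβ : 2 < β) (hν : 1 < ν)
    (hdc : 0 < dc) (hdc1 : dc ≤ 1) (hθ : 0 < θ) (hε : 0 < ε) (hε1 : ε < 1)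
    (hμ : 0 < μ) (hμε : IsNoiseThreshold α θ K ε μ) (lam0 : ℝ) (hlam0 : 0 < lam0) :
    ∃ e : ℝ → ℝ, Tendsto e atTop (𝓝 0) ∧ ∃ R : ℝ,
      ∀ zm zs σ κ : ℝ, 0 < zm → 0 < zs → 0 < σ → κ = dc * σ ^ 2 * ν ^ β / μ →
        {x : ℝ × ℝ × ℝ | ∃ q lamb lamp : ℝ, x = (q, lamb, lamp) ∧
            0 ≤ q ∧ lam0 ≤ lamb ∧ 0 ≤ lamp ∧ R ≤ zm * q / σ ^ 2 ∧
            κ / (Real.pi * ν ^ 2) + e (zm * q / σ ^ 2) ≤ zm * q * lamp * lamb ^ (α / 2) ∧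
            κ ^ (2 / α) ≤ (zm * q) ^ (2 / α) * lamb}
          ⊆ directedFeasibilityRegion α β ν dc θ K ε zm zs σ := by
  have hν0 : 0 < ν := by linarith
  have hπ := Real.pi_pos
  set b : ℝ := 2 ^ (-β) with hb
  have hb0 : 0 < b := by positivity
  have hb1 : b < 1 / 4 := by
    calc b < (2 : ℝ) ^ (-2 : ℝ) := Real.rpow_lt_rpow_of_exponent_lt one_lt_two (by linarith)
      _ = 1 / 4 := by rw [Real.rpow_neg zero_le_two, Real.rpow_two]; norm_num
  obtain ⟨a₀, ha₀, hgain⟩ := exists_forall_lt_harvest hb0 hb1 rfl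
  -- The threshold is what makes `κ / (zm * q * lamb ^ (α/2)) ≤ a₀` for all `lamb ≥ lam0`. Since `κ`
  -- is proportional to `σ²`, it depends on neither `σ` nor the lobe responses.
  refine ⟨fun _ => 0, tendsto_const_nhds, dc * ν ^ β / (μ * lam0 ^ (α / 2) * a₀), ?_⟩
  rintro zm zs σ κ hzm - hσ hκ x ⟨q, lamb, lamp, rfl, hq, hlamb, hlamp, hR, hfirst, -⟩
  have hlamb0 : 0 < lamb := hlam0.trans_le hlamb
  have hκ0 : 0 < κ := by rw [hκ]; positivity
  have hZ : 0 < zm * q := by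
    by_contra hZ
    have : zm * q / σ ^ 2 ≤ 0 := div_nonpos_of_nonpos_of_nonneg (not_lt.1 hZ) (sq_nonneg σ)
    have : 0 < dc * ν ^ β / (μ * lam0 ^ (α / 2) * a₀) := by positivity
    linarith
  have hpow : lam0 ^ (α / 2) ≤ lamb ^ (α / 2) :=
    Real.rpow_le_rpow hlam0.le hlamb (by linarith)
  set s : ℝ := lamb ^ (α / 2) with hs
  have hs0 : 0 < s := by positivity
  have hxa : κ / (zm * q * s) ≤ Real.pi * ν ^ 2 * lamp := by
    rw [add_zero, div_le_iff₀ (by positivity)] at hfirst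
    rw [div_le_iff₀ (by positivity)]
    linarith
  have hxa₀ : κ / (zm * q * s) ≤ a₀ := by
    rw [div_le_div_iff₀ (by positivity) (by positivity)] at hR
    have h1 : κ ≤ zm * q * (lam0 ^ (α / 2) * a₀) := by
      rw [hκ, div_le_iff₀ hμ]
      linarith
    rw [div_le_iff₀ (by positivity)]
    calc κ ≤ zm * q * (lam0 ^ (α / 2) * a₀) := h1
      _ ≤ zm * q * (s * a₀) := by gcongr
      _ = _ := by ring
  have hlt := hgain _ _ (by positivity) hxa₀ hxa
  -- This power meets the outage bound with equality.
  refine ⟨hq, hlamb0, hlamp, σ ^ 2 / (μ * s), by positivity, ?_, ?_⟩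
  · refine directedSustainable_of_lt (b := b) (by linarith) hν0 hdc.le hzm.le hq hlamp
      (by positivity) hb (η := b / 2) (by positivity) (by linarith) ?_
    -- The demand `p * dc` is exactly `zm * q * ν ^ (-β)` times `κ / (zm * q * s)`; this is where
    -- `κ` gets its value.
    refine lt_of_le_of_lt (le_of_eq ?_) (mul_lt_mul_of_pos_left hlt (by positivity))
    rw [hκ, Real.rpow_neg hν0.le]
    have : ν ^ β ≠ 0 := by positivity
    have : q ≠ 0 := right_ne_zero_of_mul hZ.ne'
    field_simp
  · refine outageConstraint_of_le hθ hσ hlamb0 (by positivity) hμε (le_of_eq ?_)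
    change σ ^ 2 / (σ ^ 2 / (μ * s) * s) = μ
    field_simp
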